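/- Let $d\ge 1$. For real $r>0$ let $B[r]=\{y\in\mathbb{Z}^d : |y|\le r\}$, where $|\cdot|$ is the Euclidean norm. For a finite set $S\subset\mathbb{Z}^d$ and a simple random walk $\xi$ on $\mathbb{Z}^d$ (each step is uniform among the $2d$ neighbours and independent of the past), let $t_S$ be the first time at which $\xi$ is not in $S$, and let $\mathrm{Add}[\xi,S]=S\cup\{\xi(t_S)\}$. For $x_1,\dots,x_k\in\mathbb{Z}^d$ (not necessarily distinct) let $DA_{x_1,\dots,x_k}(S)$ be the internal DLA aggregate obtained from $S$ by successively performing $S\mapsto \mathrm{Add}[\xi_i,S]$ for $i=1,\dots,k$, where $\xi_1,\dots,\xi_k$ are independent simple random walks started from $x_1,\dots,x_k$ respectively; let $DA_m(S)$ denote the aggregate obtained when $m$ particles are all launched from the origin. A random finite set $E$ stochastically dominates a random finite set $F$ if there is a coupling of the two in which $F\subseteq E$ almost surely. **Lemma.** There exists $\eta\in(0,1]$, depending only on $d$, such that for every real $n>0$, every $k\ge 0$ and every multiset $X=\{x_1,\dots,x_k\}$ of $k$ points of $B[n/2]$, listed in any order, the aggregate $DA_X(B[n])=DA_{x_1,\dots,x_k}(B[n])$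 stochastically dominates $DA_\kappa(B[n])$, where $\kappa$ is a binomial random variable with parameters $(k,\eta)$, independent of the random walks. -/

import Mathlib

open MeasureTheory ProbabilityTheory

noncomputable section

/-- The vertices of the lattice `ℤ^d`. -/
abbrev Site (d : ℕ) : Type := Fin d → ℤ

/-- Euclidean norm of a lattice point, seen as a vector of `ℝ^d`. -/
def euclNorm {d : ℕ} (y : Site d) : ℝ :=
  ‖(WithLp.toLp 2 (fun i => (y i : ℝ)) : EuclideanSpace ℝ (Fin d))‖

theorem finite_euclNorm_le (d : ℕ) (r : ℝ) : {y : Site d | euclNorm y ≤ r}.Finite := by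
  refine (Set.finite_Icc (fun _ : Fin d => -⌊r⌋) (fun _ : Fin d => ⌊r⌋)).subset ?_
  intro y hy
  have h : ∀ i, |(y i : ℝ)| ≤ r := fun i =>
    (PiLp.norm_apply_le (WithLp.toLp 2 (fun i => (y i : ℝ)) : EuclideanSpace ℝ (Fin d)) i).trans hy
  have h' : ∀ i, |y i| ≤ ⌊r⌋ := fun i => Int.le_floor.mpr (by exact_mod_cast h i)
  exact ⟨fun i => (abs_le.mp (h' i)).1, fun i => (abs_le.mp (h' i)).2⟩

/-- The lattice ball `B[r] = {y ∈ ℤ^d : |y| ≤ r}` (Euclidean distance). -/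
def latticeBall (d : ℕ) (r : ℝ) : Finset (Site d) := (finite_euclNorm_le d r).toFinset

theorem mem_latticeBall {d : ℕ} {r : ℝ} {y : Site d} :
    y ∈ latticeBall d r ↔ euclNorm y ≤ r := by
  simp [latticeBall]

/-- A step of the simple random walk: a coordinate direction and a sign. There are `2d` of them,
one for each neighbour of the origin. -/
abbrev Step (d : ℕ) : Type := Fin d × Bool

/-- The unit vector `± e_i` encoded by a step. -/
def stepVec {d : ℕ} (s : Step d) : Site d := Pi.single s.1 (if s.2 then 1 else -1)

/-- The trajectory started at `x` with the given sequence of steps. -/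
def walk {d : ℕ} (x : Site d) (σ : ℕ → Step d) (t : ℕ) : Site d :=
  x + ∑ j ∈ Finset.range t, stepVec (σ j)

/-- The first time at which the trajectory `ξ` is not in `S`. -/
def exitTime {d : ℕ} (S : Finset (Site d)) (ξ : ℕ → Site d) : ℕ := sInf {t | ξ t ∉ S}

/-- `Add[ξ, S] = S ∪ {ξ(t_S)}`. (On the null event that `ξ` never leaves `S`, this is `S`.) -/
def addParticle {d : ℕ} (ξ : ℕ → Site d) (S : Finset (Site d)) : Finset (Site d) :=
  insert (ξ (exitTime S ξ)) S

/-- The aggregate obtained from `S` by launching particles successively from the points of the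
list; the first particle uses the steps `ω 0`, the second one `ω 1`, and so on. -/
def aggregate {d : ℕ} : List (Site d) → Finset (Site d) → (ℕ → ℕ → Step d) → Finset (Site d)
  | [], S, _ => S
  | x :: l, S, ω => aggregate l (addParticle (walk x (ω 0)) S) (fun i => ω (i + 1))

/-- The law of a single step: uniform among the `2d` possibilities. -/
def stepLaw (d : ℕ) [NeZero d] : Measure (Step d) :=
  (PMF.uniformOfFintype (Step d)).toMeasure

/-- The law of a sequence of independent sequences of independent uniform steps. -/
def walksLaw (d : ℕ) [NeZero d] : Measure (ℕ → ℕ → Step d) :=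
  Measure.infinitePi fun _ => Measure.infinitePi fun _ => stepLaw d

/-- The law of the IDLA aggregate `DA_{x_1, …, x_k}(S)`, where `l = [x_1, …, x_k]`. -/
def idlaLaw {d : ℕ} [NeZero d] (l : List (Site d)) (S : Finset (Site d)) :
    Measure (Finset (Site d)) :=
  (walksLaw d).map (aggregate l S)

/-- The law of `DA_κ(S)`: a random number `κ` of particles, with law `ν` and independent of the
random walks, is launched from the origin. -/
def idlaOriginLaw {d : ℕ} [NeZero d] (ν : Measure ℕ) (S : Finset (Site d)) :
    Measure (Finset (Site d)) :=
  (ν.prod (walksLaw d)).map fun p => aggregate (List.replicate p.1 0) S p.2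

/-- A random finite set with law `μ` stochastically dominates one with law `ν`: the two can be
coupled in such a way that almost surely the former contains the latter. -/
def StochDominates {d : ℕ} (μ ν : Measure (Finset (Site d))) : Prop :=
  ∃ ρ : Measure (Finset (Site d) × Finset (Site d)), IsProbabilityMeasure ρ ∧
    ρ.map Prod.fst = μ ∧ ρ.map Prod.snd = ν ∧ ∀ᵐ p ∂ρ, p.2 ⊆ p.1

end

/-!
A single particle launched from `x` in `B[n/2]` is compared with one launched from the origin. For
a fixed aggregate `S ⊇ B[n]` and a fixed finite set `T`, the probability that a particle launched
from `y` turns `S` into `T` is a nonnegative harmonic function of `y` on `S`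
(`latticeHarmonicAt_addLaw`). A Harnack inequality whose constant does not depend on `n`
(`harnack`) shows that the law of the new aggregate for a launch from `x` is at least `η` times the
law for a launch from the origin (`smul_addLaw_zero_le`).

Hence a launch from `x` is a mixture: with probability `η` it is a launch from the origin. The two
aggregates are coupled particle by particle (`subsetCoupled_idlaLaw`). On success both receive a
particle from the origin along the same trajectory, which preserves the inclusion
(`addParticle_mono`); on failure only the larger one grows. The number of successes is binomial, by
Pascal's rule (`binomial_succ`).

The Harnack inequality comes from a gradient estimate by the maximum principle, in the manner of
Cheng and Yau. For `u > 0` harmonic and `f = √u`, expanding squares gives `|∇f|² = -2 f Δf`. Because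
the steps of the lattice commute, `Δ|∇f|²` is a sum of Cauchy–Schwarz deficits, which yields
`Δ|∇f|² ≥ c |∇f|⁴ / u` (`gradSq_laplacian_ge`). At the point where
`(1 - |x|² / n²)² |∇f|² / u` is largest this inequality forces the maximum to be `O(n⁻²)`
(`cutoff_sq_mul_gradSq_le`). So `f` changes by a factor `1 + O(1 / n)` in one step within `B[n/2]`,
and any point there is joined to the origin by a path of `O(n)` steps.
-/

noncomputable section

/-! ### A Bochner-type inequality for square roots of harmonic functions -/

/-- The function `u` is harmonic at `x`: the values at the neighbours of `x` average to `u x`. -/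
def LatticeHarmonicAt {d : ℕ} (u : Site d → ℝ) (x : Site d) : Prop :=
  ∑ s : Step d, u (x + stepVec s) = Fintype.card (Step d) * u x

/-- The squared discrete gradient `∑ₛ (f (x + s) - f x)²` over the neighbours of `x`. -/
def gradSq {d : ℕ} (f : Site d → ℝ) (x : Site d) : ℝ :=
  ∑ s : Step d, (f (x + stepVec s) - f x) ^ 2

theorem gradSq_nonneg {d : ℕ} (f : Site d → ℝ) (x : Site d) : 0 ≤ gradSq f x :=
  Finset.sum_nonneg fun _ _ => sq_nonneg _

/-- The step opposite to a given one. -/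
def oppStep {d : ℕ} : Step d ≃ Step d := (Equiv.refl _).prodCongr Equiv.boolNot

theorem stepVec_oppStep {d : ℕ} (s : Step d) : stepVec (oppStep s) = -stepVec s := by
  obtain ⟨i, b⟩ := s
  cases b <;> simp [stepVec, oppStep, ← Pi.single_neg]

theorem one_le_card_step (d : ℕ) [NeZero d] : (1 : ℝ) ≤ Fintype.card (Step d) := by
  exact_mod_cast Fintype.card_pos

/-- A positive function with harmonic square grows by at most a constant factor in one step. -/
theorem le_card_mul_of_harmonic_sq {d : ℕ} [NeZero d] {f : Site d → ℝ} (hf : ∀ y, 0 < f y)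
    {x : Site d} (hx : LatticeHarmonicAt (fun y => f y ^ 2) x) (s : Step d) :
    f (x + stepVec s) ≤ Fintype.card (Step d) * f x := by
  have h1 := one_le_card_step d
  have h2 : f (x + stepVec s) ^ 2 ≤ Fintype.card (Step d) * f x ^ 2 := by
    rw [← hx]
    exact Finset.single_le_sum (f := fun s => f (x + stepVec s) ^ 2)
      (fun _ _ => sq_nonneg _) (Finset.mem_univ s)
  refine le_of_sq_le_sq ?_ (by have := hf x; positivity)
  nlinarith [sq_nonneg (f x)]

/-- Expanding the squares: `gradSq f = -2 f Δf` where `f²` is harmonic. -/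
theorem gradSq_eq_of_harmonic_sq {d : ℕ} {f : Site d → ℝ} {x : Site d}
    (hx : LatticeHarmonicAt (fun y => f y ^ 2) x) :
    gradSq f x = 2 * f x * ∑ s : Step d, (f x - f (x + stepVec s)) := by
  have hx' : ∑ s : Step d, f (x + stepVec s) ^ 2 = Fintype.card (Step d) * f x ^ 2 := hx
  have : ∀ s : Step d, (f (x + stepVec s) - f x) ^ 2 =
      f (x + stepVec s) ^ 2 - f x ^ 2 + 2 * f x * (f x - f (x + stepVec s)) := fun s => by ring
  simp only [gradSq, this, Finset.sum_add_distrib, ← Finset.mul_sum]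
  rw [Finset.sum_sub_distrib, hx']
  simp

theorem gradSq_le_of_harmonic_sq {d : ℕ} {f : Site d → ℝ} (hf : ∀ y, 0 < f y) {x : Site d}
    (hx : LatticeHarmonicAt (fun y => f y ^ 2) x) :
    gradSq f x ≤ 2 * Fintype.card (Step d) * f x ^ 2 := by
  rw [gradSq_eq_of_harmonic_sq hx]
  have : ∑ s : Step d, (f x - f (x + stepVec s)) ≤ ∑ s : Step d, f x :=
    Finset.sum_le_sum fun s _ => by linarith [hf (x + stepVec s)]
  simp only [Finset.sum_const, Finset.card_univ, nsmul_eq_mul] at this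
  nlinarith [hf x]

/-- By the inequality of the arithmetic and geometric means, a second difference is controlled by
its multiplicative counterpart. -/
theorem mul_two_sub_le_abs {a b c : ℝ} (ha : 0 < a) (hb : 0 < b) (hc : 0 < c) :
    c * (2 * c - a - b) ≤ 2 * |b * a - c ^ 2| := by
  rcases le_total (b * a) (c ^ 2) with h | h
  · rw [abs_of_nonpos (by linarith)]
    have : 2 * (a * b) ≤ c * (a + b) := by
      refine le_of_sq_le_sq ?_ (by positivity)
      nlinarith [mul_nonneg (sq_nonneg c) (sq_nonneg (a - b)), mul_pos ha hb,
        mul_nonneg (mul_pos ha hb).le (sub_nonneg.2 h)]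
    linarith
  · rw [abs_of_nonneg (by linarith)]
    have : 2 * c ≤ a + b := by
      refine le_of_sq_le_sq ?_ (by positivity)
      nlinarith [sq_nonneg (a - b)]
    nlinarith

/-- A Bochner-type inequality. If `f > 0` and `f²` is harmonic at `x` and at its neighbours, then
`gradSq f` is subharmonic at `x`, with a quantitative lower bound on its Laplacian. Since the
steps commute, the Laplacian of `gradSq f` is a sum of deficits in the Cauchy–Schwarz inequality
between `t ↦ f (x + t)` and `t ↦ f (x + s + t)`; only the contribution of `t = -s` to each deficit
is kept. -/
theorem gradSq_laplacian_ge {d : ℕ} [NeZero d] {f : Site d → ℝ} (hf : ∀ y, 0 < f y) {x : Site d}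
    (hx : LatticeHarmonicAt (fun y => f y ^ 2) x)
    (hxs : ∀ s : Step d, LatticeHarmonicAt (fun y => f y ^ 2) (x + stepVec s)) :
    gradSq f x ^ 2 / (4 * Fintype.card (Step d) ^ 2 * f x ^ 2) ≤
      ∑ t : Step d, (gradSq f (x + stepVec t) - gradSq f x) := by
  set D : ℝ := ((Fintype.card (Step d) : ℕ) : ℝ) with hD
  have hD1 : 1 ≤ D := one_le_card_step d
  have hfx := hf x
  set p : Step d → ℝ := fun s => f (x + stepVec (oppStep s)) * f (x + stepVec s) - f x ^ 2 with hp
  have hx' : ∑ s : Step d, f (x + stepVec s) ^ 2 = D * f x ^ 2 := hx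
  have hxs' : ∀ t : Step d, ∑ s : Step d, f (x + stepVec t + stepVec s) ^ 2 =
    D * f (x + stepVec t) ^ 2 := hxs
  have hLap : ∑ t : Step d, (gradSq f (x + stepVec t) - gradSq f x) =
      2 * ∑ s : Step d, (D * f x * f (x + stepVec s) -
        ∑ t : Step d, f (x + stepVec t) * f (x + stepVec s + stepVec t)) := by
    rw [Finset.sum_sub_distrib, Finset.sum_congr rfl fun t _ => gradSq_eq_of_harmonic_sq (hxs t),
      gradSq_eq_of_harmonic_sq hx]
    simp only [Finset.sum_sub_distrib, mul_sub, Finset.mul_sum, Finset.sum_const, Finset.card_univ,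
      nsmul_eq_mul, ← hD]
    have e1 : ∑ t : Step d, 2 * f (x + stepVec t) * (D * f (x + stepVec t)) =
        2 * D * (D * f x ^ 2) := by
      rw [← hx', Finset.mul_sum]; exact Finset.sum_congr rfl fun _ _ => by ring
    have e2 : ∑ t : Step d, ∑ s : Step d,
        2 * f (x + stepVec t) * f (x + stepVec t + stepVec s) =
        ∑ t : Step d, ∑ s : Step d, 2 * (f (x + stepVec s) * f (x + stepVec t + stepVec s)) := by
      rw [Finset.sum_comm]
      exact Finset.sum_congr rfl fun _ _ => Finset.sum_congr rfl fun _ _ => by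
        rw [add_right_comm]; ring
    have e3 : ∑ s : Step d, 2 * (D * f x * f (x + stepVec s)) =
      ∑ s : Step d, D * (2 * f x * f (x + stepVec s)) :=
      Finset.sum_congr rfl fun _ _ => by ring
    rw [e1, e2, e3]; ring
  have hCS : ∀ s : Step d, p s ^ 2 / (2 * (D * f x ^ 2)) ≤ D * f x * f (x + stepVec s) -
        ∑ t : Step d, f (x + stepVec t) * f (x + stepVec s + stepVec t) := by
    intro s
    have hs := hf (x + stepVec s)
    have hsum : ∑ t : Step d,
        (f (x + stepVec t) * f (x + stepVec s) - f (x + stepVec s + stepVec t) * f x) ^ 2 =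
        2 * f x * f (x + stepVec s) * (D * f x * f (x + stepVec s) -
        ∑ t : Step d, f (x + stepVec t) * f (x + stepVec s + stepVec t)) := by
      have : ∀ t : Step d,
        (f (x + stepVec t) * f (x + stepVec s) - f (x + stepVec s + stepVec t) * f x) ^ 2 =
        f (x + stepVec s) ^ 2 * f (x + stepVec t) ^ 2 +
          f x ^ 2 * f (x + stepVec s + stepVec t) ^ 2 - 2 * f x * f (x + stepVec s) *
          (f (x + stepVec t) * f (x + stepVec s + stepVec t)) := fun t => by ring
      rw [Finset.sum_congr rfl fun t _ => this t, Finset.sum_sub_distrib, Finset.sum_add_distrib,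
        ← Finset.mul_sum, ← Finset.mul_sum, ← Finset.mul_sum, hx', hxs']
      ring
    have hp1 : p s ^ 2 ≤ 2 * f x * f (x + stepVec s) * (D * f x * f (x + stepVec s) -
        ∑ t : Step d, f (x + stepVec t) * f (x + stepVec s + stepVec t)) := by
      rw [← hsum]
      refine le_trans (le_of_eq ?_) (Finset.single_le_sum (f := fun t : Step d =>
        (f (x + stepVec t) * f (x + stepVec s) - f (x + stepVec s + stepVec t) * f x) ^ 2)
        (fun _ _ => sq_nonneg _) (Finset.mem_univ (oppStep s)))
      simp only [hp, stepVec_oppStep, add_neg_cancel_right]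
      ring
    have hle : f (x + stepVec s) ≤ D * f x := le_card_mul_of_harmonic_sq hf hx s
    have hnn : 0 ≤ D * f x * f (x + stepVec s) -
        ∑ t : Step d, f (x + stepVec t) * f (x + stepVec s + stepVec t) := by
      by_contra hneg
      have := mul_neg_of_pos_of_neg (by positivity : 0 < 2 * f x * f (x + stepVec s))
        (not_le.1 hneg)
      nlinarith [sq_nonneg (p s)]
    rw [div_le_iff₀ (by positivity)]
    refine hp1.trans ?_
    rw [mul_comm]
    refine mul_le_mul_of_nonneg_left ?_ hnn
    nlinarith
  -- Pairing each step with its opposite bounds the gradient by second differences.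
  have hgrad : gradSq f x ≤ 2 * ∑ s : Step d, |p s| := by
    have hopp : ∑ s : Step d, (f x - f (x + stepVec s)) =
        ∑ s : Step d, (f x - f (x + stepVec (oppStep s))) :=
      (Equiv.sum_comp oppStep fun s => f x - f (x + stepVec s)).symm
    have : 2 * f x * ∑ s : Step d, (f x - f (x + stepVec s)) =
        ∑ s : Step d, f x * (2 * f x - f (x + stepVec s) - f (x + stepVec (oppStep s))) := by
      rw [two_mul, add_mul]
      nth_rewrite 2 [hopp]
      rw [← mul_add, ← Finset.sum_add_distrib, Finset.mul_sum]
      exact Finset.sum_congr rfl fun _ _ => by ring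
    rw [gradSq_eq_of_harmonic_sq hx, this, Finset.mul_sum]
    exact Finset.sum_le_sum fun s _ => mul_two_sub_le_abs (hf _) (hf _) (hf _)
  have hsq : gradSq f x ^ 2 ≤ 4 * (D * ∑ s : Step d, p s ^ 2) := by
    have h1 : (∑ s : Step d, |p s|) ^ 2 ≤ D * ∑ s : Step d, p s ^ 2 := by
      simpa [sq_abs, hD] using sq_sum_le_card_mul_sum_sq (s := Finset.univ) (f := fun s => |p s|)
    nlinarith [gradSq_nonneg f x]
  rw [hLap]
  refine le_trans ?_ (mul_le_mul_of_nonneg_left (Finset.sum_le_sum fun s _ => hCS s) zero_le_two)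
  rw [← Finset.sum_div, div_le_iff₀ (by positivity)]
  have : 2 * ((∑ s : Step d, p s ^ 2) / (2 * (D * f x ^ 2))) * (4 * D ^ 2 * f x ^ 2) =
      4 * (D * ∑ s : Step d, p s ^ 2) := by
    field_simp
  rw [this]; exact hsq

/-! ### The gradient estimate -/

theorem euclNorm_sq {d : ℕ} (x : Site d) : euclNorm x ^ 2 = ∑ i, (x i : ℝ) ^ 2 := by
  simp [euclNorm, EuclideanSpace.norm_sq_eq]

theorem euclNorm_nonneg {d : ℕ} (x : Site d) : 0 ≤ euclNorm x := norm_nonneg _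

theorem abs_apply_le_euclNorm {d : ℕ} (x : Site d) (i : Fin d) : |(x i : ℝ)| ≤ euclNorm x :=
  PiLp.norm_apply_le (WithLp.toLp 2 (fun i => (x i : ℝ)) : EuclideanSpace ℝ (Fin d)) i

theorem euclNorm_zero {d : ℕ} : euclNorm (0 : Site d) = 0 := by
  have := euclNorm_sq (0 : Site d)
  simpa using this

theorem zero_mem_latticeBall {d : ℕ} {r : ℝ} (hr : 0 ≤ r) : (0 : Site d) ∈ latticeBall d r := by
  rw [mem_latticeBall, euclNorm_zero]; exact hr

/-- The sign of a step, as a real number. -/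
def stepSign {d : ℕ} (s : Step d) : ℝ := if s.2 then 1 else -1

theorem euclNorm_add_stepVec_sq {d : ℕ} (x : Site d) (s : Step d) :
    euclNorm (x + stepVec s) ^ 2 = euclNorm x ^ 2 + 2 * stepSign s * x s.1 + 1 := by
  have key : ∀ i, ((x + stepVec s) i : ℝ) ^ 2 =
      (x i : ℝ) ^ 2 + if i = s.1 then 2 * stepSign s * x s.1 + 1 else 0 := by
    intro i
    obtain ⟨j, b⟩ := s
    by_cases h : i = j
    · subst h
      cases b <;> simp [stepVec, stepSign] <;> ring
    · simp [stepVec, h]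
  rw [euclNorm_sq, euclNorm_sq, Finset.sum_congr rfl fun i _ => key i, Finset.sum_add_distrib]
  simp [add_assoc]

/-- The quadratic cutoff `1 - |x|² / n²`, which vanishes on the boundary of the ball of
radius `n`. -/
def cutoff {d : ℕ} (n : ℝ) (x : Site d) : ℝ := 1 - euclNorm x ^ 2 / n ^ 2

theorem sum_cutoff_sub {d : ℕ} (n : ℝ) (x : Site d) :
    ∑ s : Step d, (cutoff n (x + stepVec s) - cutoff n x) = -(Fintype.card (Step d) / n ^ 2) := by
  have h : ∀ s : Step d, cutoff n (x + stepVec s) - cutoff n x =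
      -((2 * stepSign s * x s.1) / n ^ 2) - 1 / n ^ 2 := fun s => by
    rw [cutoff, cutoff, euclNorm_add_stepVec_sq]; ring
  have h0 : ∑ s : Step d, -((2 * stepSign s * x s.1) / n ^ 2) = 0 := by
    rw [Fintype.sum_prod_type]
    refine Finset.sum_eq_zero fun i _ => ?_
    simp [stepSign]
    ring
  rw [Finset.sum_congr rfl fun s _ => h s, Finset.sum_sub_distrib, h0]
  simp [div_eq_mul_inv]

theorem abs_cutoff_sub_le {d : ℕ} {n : ℝ} (hn : 1 ≤ n) {x : Site d} (hx : euclNorm x ≤ n)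
    (s : Step d) : |cutoff n (x + stepVec s) - cutoff n x| ≤ 3 / n := by
  have h : cutoff n (x + stepVec s) - cutoff n x = -((2 * stepSign s * x s.1 + 1) / n ^ 2) := by
    rw [cutoff, cutoff, euclNorm_add_stepVec_sq]; ring
  have h1 := abs_le.1 ((abs_apply_le_euclNorm x s.1).trans hx)
  have h2 : |2 * stepSign s * x s.1 + 1| ≤ 3 * n := by
    unfold stepSign
    rw [abs_le]
    split_ifs <;> constructor <;> linarith
  have hn0 : 0 < n := by linarith
  rw [h, abs_neg, abs_div, abs_of_pos (by positivity : 0 < n ^ 2), div_le_div_iff₀ (by positivity)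
    hn0]
  nlinarith

theorem inv_sq_sub_inv_sq_le {a e : ℝ} (ha : 0 < a) (he : |e| ≤ a / 2) :
    1 / (a + e) ^ 2 - 1 / a ^ 2 ≤ -2 * e / a ^ 3 + 16 * e ^ 2 / a ^ 4 := by
  obtain ⟨h1, h2⟩ := abs_le.1 he
  have hb : a / 2 ≤ a + e := by linarith
  have hb0 : 0 < a + e := by linarith
  have h3 : 1 / (a + e) ^ 2 - 1 / a ^ 2 + 2 * e / a ^ 3 =
      e ^ 2 * (3 * a + 2 * e) / (a ^ 3 * (a + e) ^ 2) := by
    field_simp; ring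
  have h4 : e ^ 2 * (3 * a + 2 * e) / (a ^ 3 * (a + e) ^ 2) ≤ 16 * e ^ 2 / a ^ 4 := by
    have h5 : e ^ 2 * (3 * a + 2 * e) ≤ e ^ 2 * (4 * a) :=
      mul_le_mul_of_nonneg_left (by linarith) (sq_nonneg e)
    have h6 : a ^ 2 ≤ 4 * (a + e) ^ 2 := by nlinarith
    rw [div_le_div_iff₀ (by positivity) (by positivity)]
    calc e ^ 2 * (3 * a + 2 * e) * a ^ 4 ≤ e ^ 2 * (4 * a) * a ^ 4 := by gcongr
      _ = 4 * (e ^ 2 * a ^ 3) * a ^ 2 := by ring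
      _ ≤ 4 * (e ^ 2 * a ^ 3) * (4 * (a + e) ^ 2) := by gcongr
      _ = 16 * e ^ 2 * (a ^ 3 * (a + e) ^ 2) := by ring
  have : -2 * e / a ^ 3 = -(2 * e / a ^ 3) := by ring
  rw [this]
  linarith

theorem abs_inv_sq_sub_inv_sq_le {a e : ℝ} (ha : 0 < a) (he : |e| ≤ a / 2) :
    |1 / (a + e) ^ 2 - 1 / a ^ 2| ≤ 10 * |e| / a ^ 3 := by
  obtain ⟨h1, h2⟩ := abs_le.1 he
  have hb0 : 0 < a + e := by linarith
  have h3 : 1 / (a + e) ^ 2 - 1 / a ^ 2 = -(e * (2 * a + e)) / (a ^ 2 * (a + e) ^ 2) := by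
    field_simp; ring
  have h6 : a ^ 2 ≤ 4 * (a + e) ^ 2 := by nlinarith
  rw [h3, abs_div, abs_neg, abs_mul, abs_of_pos (by linarith : 0 < 2 * a + e),
    abs_of_pos (by positivity : 0 < a ^ 2 * (a + e) ^ 2),
    div_le_div_iff₀ (by positivity) (by positivity)]
  calc |e| * (2 * a + e) * a ^ 3 ≤ |e| * (5 / 2 * a) * a ^ 3 := by gcongr; linarith
    _ = 5 / 2 * |e| * a ^ 2 * a ^ 2 := by ring
    _ ≤ 5 / 2 * |e| * a ^ 2 * (4 * (a + e) ^ 2) := by gcongr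
    _ = 10 * |e| * (a ^ 2 * (a + e) ^ 2) := by ring

/-- The contribution of one neighbour to the Laplacian of `f² / cutoff²` at the point where the
localised gradient is largest. Here `c = f x`, `b = f (x + s)`, `a` is the cutoff at `x`, `e` its
increment and `w / a` the logarithmic gradient bound. The term linear in `e` is kept exactly,
because the increments of the cutoff cancel to order `n⁻²` when summed over the neighbours; the
other terms carry a factor `n⁻²` or `w / n`. -/
theorem sq_mul_inv_sq_sub_le {a b c e w n D : ℝ} (ha : 0 < a) (hn : 0 < n) (hc : 0 < c)
    (hb : 0 < b) (hD : 1 ≤ D) (he : |e| ≤ a / 2) (hen : |e| ≤ 3 / n) (hbc : b ≤ D * c)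
    (hw : 0 ≤ w) (hdiff : |b - c| ≤ w * c / a) :
    b ^ 2 * (1 / (a + e) ^ 2 - 1 / a ^ 2) ≤
      c ^ 2 * (-2 / a ^ 3 * e + 144 / (n ^ 2 * a ^ 4) + 60 * D * w / (n * a ^ 4)) := by
  have h1 := inv_sq_sub_inv_sq_le ha he
  have h2 := abs_inv_sq_sub_inv_sq_le ha he
  have h3 : 16 * e ^ 2 / a ^ 4 ≤ 144 / (n ^ 2 * a ^ 4) := by
    have : e ^ 2 ≤ (3 / n) ^ 2 := by rw [← sq_abs]; gcongr
    calc 16 * e ^ 2 / a ^ 4 ≤ 16 * (3 / n) ^ 2 / a ^ 4 := by gcongr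
      _ = 144 / (n ^ 2 * a ^ 4) := by field_simp; ring
  have h4 : |b ^ 2 - c ^ 2| ≤ 2 * D * c * (w * c / a) := by
    rw [sq_sub_sq, abs_mul, abs_of_pos (by linarith : 0 < b + c)]
    have : b + c ≤ 2 * D * c := by nlinarith
    gcongr
  have h5 : |1 / (a + e) ^ 2 - 1 / a ^ 2| ≤ 30 / (n * a ^ 3) := by
    refine h2.trans ?_
    calc 10 * |e| / a ^ 3 ≤ 10 * (3 / n) / a ^ 3 := by gcongr
      _ = 30 / (n * a ^ 3) := by field_simp; ring
  have h6 : (b ^ 2 - c ^ 2) * (1 / (a + e) ^ 2 - 1 / a ^ 2) ≤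
      c ^ 2 * (60 * D * w / (n * a ^ 4)) := by
    refine (le_abs_self _).trans ?_
    rw [abs_mul]
    refine (mul_le_mul h4 h5 (abs_nonneg _) (by positivity)).trans (le_of_eq ?_)
    field_simp; ring
  have h7 : c ^ 2 * (1 / (a + e) ^ 2 - 1 / a ^ 2) ≤
      c ^ 2 * (-2 / a ^ 3 * e + 144 / (n ^ 2 * a ^ 4)) := by
    refine mul_le_mul_of_nonneg_left (h1.trans ?_) (sq_nonneg c)
    have : -2 * e / a ^ 3 = -2 / a ^ 3 * e := by ring
    linarith
  calc b ^ 2 * (1 / (a + e) ^ 2 - 1 / a ^ 2) =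
      c ^ 2 * (1 / (a + e) ^ 2 - 1 / a ^ 2) +
        (b ^ 2 - c ^ 2) * (1 / (a + e) ^ 2 - 1 / a ^ 2) := by ring
    _ ≤ _ := add_le_add h7 h6
    _ = _ := by ring

theorem cutoff_nonneg {d : ℕ} {n : ℝ} (hn : 0 < n) {x : Site d} (hx : x ∈ latticeBall d n) :
    0 ≤ cutoff n x := by
  have h := mem_latticeBall.1 hx
  rw [cutoff, sub_nonneg, div_le_one (by positivity)]
  exact pow_le_pow_left₀ (euclNorm_nonneg x) h 2

theorem mem_latticeBall_of_cutoff_pos {d : ℕ} {n : ℝ} (hn : 0 < n) {x : Site d}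
    (hx : 0 < cutoff n x) : x ∈ latticeBall d n := by
  rw [cutoff, sub_pos, div_lt_one (by positivity)] at hx
  exact mem_latticeBall.2 (le_of_sq_le_sq hx.le hn.le)

/-- A discrete Cheng–Yau gradient estimate. The Bochner-type inequality is applied at the point of
the ball where `cutoff² · gradSq f / f²` is largest. If the cutoff there is of order `1 / n`, the
trivial bound on the gradient suffices; otherwise the neighbours are in the ball as well, and the
maximality bounds the Laplacian of `gradSq f` from above. -/
theorem cutoff_sq_mul_gradSq_le {d : ℕ} [NeZero d] {n : ℝ} (hn : 0 < n) {f : Site d → ℝ}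
    (hf : ∀ y, 0 < f y)
    (hu : ∀ x ∈ latticeBall d n, LatticeHarmonicAt (fun y => f y ^ 2) x)
    {x : Site d} (hx : x ∈ latticeBall d n) :
    cutoff n x ^ 2 * gradSq f x ≤ (585 * Fintype.card (Step d) ^ 4 / n) ^ 2 * f x ^ 2 := by
  set D : ℝ := ((Fintype.card (Step d) : ℕ) : ℝ) with hD
  have hD1 : 1 ≤ D := one_le_card_step d
  set F : Site d → ℝ := fun y => cutoff n y ^ 2 * gradSq f y / f y ^ 2 with hF
  obtain ⟨x₀, hx₀, hmax⟩ := (latticeBall d n).exists_max_image F ⟨0, zero_mem_latticeBall hn.le⟩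
  have hF0 : 0 ≤ F x₀ := by have := gradSq_nonneg f x₀; simp only [hF]; positivity
  suffices hM : F x₀ ≤ (585 * D ^ 4 / n) ^ 2 by
    have := (hmax x hx).trans hM
    simp only [hF] at this
    rwa [div_le_iff₀ (by have := hf x; positivity)] at this
  have hc := hf x₀
  set a := cutoff n x₀ with ha
  have ha0 : 0 ≤ a := cutoff_nonneg hn hx₀
  have hDpow : D ≤ D ^ 8 := le_self_pow₀ hD1 (by norm_num)
  rcases le_or_gt a (8 / n) with hsmall | hbig
  · have h1 : F x₀ ≤ (8 / n) ^ 2 * (2 * D) := by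
      simp only [hF]
      rw [div_le_iff₀ (by positivity), mul_assoc]
      have := gradSq_le_of_harmonic_sq hf (hu x₀ hx₀)
      have h0 := gradSq_nonneg f x₀
      gcongr
    refine h1.trans ?_
    have : (585 * D ^ 4 / n) ^ 2 - (8 / n) ^ 2 * (2 * D) = (585 ^ 2 * D ^ 8 - 128 * D) / n ^ 2 := by
      field_simp; ring
    have : 0 ≤ (585 ^ 2 * D ^ 8 - 128 * D) / n ^ 2 := by
      apply div_nonneg _ (by positivity); linarith
    linarith
  have ha_pos : 0 < a := lt_trans (by positivity) hbig
  have ha1 : a ≤ 1 := by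
    rw [ha, cutoff]; have : 0 ≤ euclNorm x₀ ^ 2 / n ^ 2 := by positivity
    linarith
  have hn8 : 8 < n := by
    have := hbig.trans_le ha1
    rwa [div_lt_one hn] at this
  set e : Step d → ℝ := fun s => cutoff n (x₀ + stepVec s) - a with he
  have hen : ∀ s, |e s| ≤ 3 / n := fun s =>
    abs_cutoff_sub_le (by linarith) (mem_latticeBall.1 hx₀) s
  have he2 : ∀ s, |e s| ≤ a / 2 := fun s => (hen s).trans <| by
    have : 3 / n ≤ (8 / n) / 2 := by rw [div_div, div_le_div_iff₀ hn (by positivity)]; linarith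
    linarith
  have hcut : ∀ s, cutoff n (x₀ + stepVec s) = a + e s := fun s => by simp [he]
  have hcutpos : ∀ s, 0 < a + e s := fun s => by have := (abs_le.1 (he2 s)).1; linarith
  have hnb : ∀ s, x₀ + stepVec s ∈ latticeBall d n := fun s =>
    mem_latticeBall_of_cutoff_pos hn (by rw [hcut]; exact hcutpos s)
  set w := √(F x₀) with hw
  have hwsq : w ^ 2 = F x₀ := Real.sq_sqrt hF0
  have hw0 : 0 ≤ w := Real.sqrt_nonneg _
  have hg0 : gradSq f x₀ = w ^ 2 * f x₀ ^ 2 / a ^ 2 := by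
    rw [hwsq]; simp only [hF]; field_simp; rw [ha]
  have hgs : ∀ s, gradSq f (x₀ + stepVec s) ≤ w ^ 2 * f (x₀ + stepVec s) ^ 2 / (a + e s) ^ 2 := by
    intro s
    have h := hmax _ (hnb s)
    have := hf (x₀ + stepVec s)
    have := hcutpos s
    rw [hwsq, le_div_iff₀ (by positivity)]
    simp only [hF] at h ⊢
    rw [div_le_iff₀ (by positivity), hcut] at h
    linarith
  have hdiff : ∀ s, |f (x₀ + stepVec s) - f x₀| ≤ w * f x₀ / a := by
    intro s
    refine abs_le_of_sq_le_sq ?_ (by positivity)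
    have : (w * f x₀ / a) ^ 2 = gradSq f x₀ := by rw [hg0]; ring
    rw [this]
    exact Finset.single_le_sum (f := fun s => (f (x₀ + stepVec s) - f x₀) ^ 2)
      (fun _ _ => sq_nonneg _) (Finset.mem_univ s)
  have hB := gradSq_laplacian_ge hf (hu x₀ hx₀) (fun s => hu _ (hnb s))
  rw [← hD] at hB
  have hsum : ∑ s : Step d, f (x₀ + stepVec s) ^ 2 = D * f x₀ ^ 2 := hu x₀ hx₀
  -- Maximality, and the harmonicity of `f²` at `x₀`, turn the Laplacian of `gradSq f` into that of
  -- `1 / cutoff²` with the weights `f²`.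
  have hup : ∑ s : Step d, (gradSq f (x₀ + stepVec s) - gradSq f x₀) ≤
      w ^ 2 * ∑ s : Step d, f (x₀ + stepVec s) ^ 2 * (1 / (a + e s) ^ 2 - 1 / a ^ 2) := by
    have h1 : ∑ s : Step d, (gradSq f (x₀ + stepVec s) - gradSq f x₀) ≤
        ∑ s : Step d, (w ^ 2 * f (x₀ + stepVec s) ^ 2 / (a + e s) ^ 2 - gradSq f x₀) :=
      Finset.sum_le_sum fun s _ => sub_le_sub_right (hgs s) _
    refine h1.trans (le_of_eq ?_)
    have h2 : ∑ s : Step d, f (x₀ + stepVec s) ^ 2 * (1 / (a + e s) ^ 2 - 1 / a ^ 2) =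
        ∑ s : Step d, f (x₀ + stepVec s) ^ 2 * (1 / (a + e s) ^ 2) -
          D * f x₀ ^ 2 * (1 / a ^ 2) := by
      rw [← hsum, Finset.sum_mul, ← Finset.sum_sub_distrib]
      exact Finset.sum_congr rfl fun _ _ => by ring
    rw [h2, Finset.sum_sub_distrib, mul_sub, Finset.mul_sum, hg0]
    congr 1
    · exact Finset.sum_congr rfl fun _ _ => by ring
    · rw [Finset.sum_const, Finset.card_univ, nsmul_eq_mul, ← hD]; ring
  have hterm : ∑ s : Step d, f (x₀ + stepVec s) ^ 2 * (1 / (a + e s) ^ 2 - 1 / a ^ 2) ≤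
      D * f x₀ ^ 2 / a ^ 4 * (146 / n ^ 2 + 60 * D * w / n) := by
    have h1 := Finset.sum_le_sum fun s (_ : s ∈ Finset.univ) =>
      sq_mul_inv_sq_sub_le ha_pos hn hc (hf (x₀ + stepVec s)) hD1 (he2 s) (hen s)
        (le_card_mul_of_harmonic_sq hf (hu x₀ hx₀) s) hw0 (hdiff s)
    refine h1.trans ?_
    rw [← Finset.mul_sum, Finset.sum_add_distrib, Finset.sum_add_distrib, ← Finset.mul_sum,
      sum_cutoff_sub]
    simp only [Finset.sum_const, Finset.card_univ, nsmul_eq_mul, ← hD]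
    have h2 : -2 / a ^ 3 * -(D / n ^ 2) ≤ D * (2 / (n ^ 2 * a ^ 4)) := by
      have : -2 / a ^ 3 * -(D / n ^ 2) = D * (2 * a / (n ^ 2 * a ^ 4)) := by field_simp
      rw [this]
      gcongr
      linarith
    calc f x₀ ^ 2 * (-2 / a ^ 3 * -(D / n ^ 2) + D * (144 / (n ^ 2 * a ^ 4)) +
          D * (60 * D * w / (n * a ^ 4)))
        ≤ f x₀ ^ 2 * (D * (2 / (n ^ 2 * a ^ 4)) + D * (144 / (n ^ 2 * a ^ 4)) +
          D * (60 * D * w / (n * a ^ 4))) := by gcongr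
      _ = _ := by field_simp; ring
  have hfin : w ^ 2 * w ^ 2 ≤ w ^ 2 * (4 * D ^ 3 * (146 / n ^ 2 + 60 * D * w / n)) := by
    have h1 := hB.trans (hup.trans (mul_le_mul_of_nonneg_left hterm (sq_nonneg w)))
    rw [hg0, div_le_iff₀ (by positivity)] at h1
    have h2 : (w ^ 2 * f x₀ ^ 2 / a ^ 2) ^ 2 = w ^ 2 * w ^ 2 * (f x₀ ^ 4 / a ^ 4) := by ring
    have h3 : w ^ 2 * (D * f x₀ ^ 2 / a ^ 4 * (146 / n ^ 2 + 60 * D * w / n)) *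
        (4 * D ^ 2 * f x₀ ^ 2) =
        w ^ 2 * (4 * D ^ 3 * (146 / n ^ 2 + 60 * D * w / n)) * (f x₀ ^ 4 / a ^ 4) := by ring
    rw [h2, h3] at h1
    exact le_of_mul_le_mul_right h1 (by positivity)
  -- `w n` satisfies a quadratic inequality whose coefficients depend on `D` only.
  rw [← hwsq]
  refine pow_le_pow_left₀ hw0 ?_ 2
  rw [le_div_iff₀ hn]
  by_contra hcon
  push Not at hcon
  have hD4 : 1 ≤ D ^ 4 := one_le_pow₀ hD1
  have hD34 : D ^ 3 ≤ D ^ 4 := pow_le_pow_right₀ hD1 (by norm_num)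
  have hwn : 0 < w * n := lt_trans (by positivity) hcon
  have hwpos : 0 < w := (pos_iff_pos_of_mul_pos hwn).2 hn
  have h1 := le_of_mul_le_mul_left hfin (by positivity)
  have h2 : (w * n) ^ 2 ≤ 584 * D ^ 3 + 240 * D ^ 4 * (w * n) := by
    have := mul_le_mul_of_nonneg_right h1 (sq_nonneg n)
    calc (w * n) ^ 2 = w ^ 2 * n ^ 2 := by ring
      _ ≤ _ := this
      _ = _ := by field_simp; ring
  have h3 : 585 * D ^ 4 * (w * n) ≤ (w * n) ^ 2 := by nlinarith
  have h4 : D ^ 4 * 585 ≤ D ^ 4 * (w * n) := by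
    have : 585 ≤ w * n := by linarith
    gcongr
  linarith

/-! ### The Harnack inequality -/

/-- The constant in the logarithmic gradient bound on the ball of half the radius. -/
def gradConst (d : ℕ) : ℝ := 2 * (585 * Fintype.card (Step d) ^ 4)

theorem gradConst_nonneg (d : ℕ) : 0 ≤ gradConst d := by unfold gradConst; positivity

/-- On the ball of half the radius the cutoff is at least `3 / 4`, so the gradient estimate bounds
the relative change in one step by `O(1 / n)`. -/
theorem le_one_add_mul_of_mem_half_ball {d : ℕ} [NeZero d] {n : ℝ} (hn : 0 < n) {f : Site d → ℝ}
    (hf : ∀ y, 0 < f y)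
    (hu : ∀ x ∈ latticeBall d n, LatticeHarmonicAt (fun y => f y ^ 2) x)
    {x : Site d} (hx : x ∈ latticeBall d (n / 2)) (s : Step d) :
    f (x + stepVec s) ≤ (1 + gradConst d / n) * f x := by
  have hx2 := mem_latticeBall.1 hx
  have hxn : x ∈ latticeBall d n := mem_latticeBall.2 (by linarith)
  have h := cutoff_sq_mul_gradSq_le hn hf hu hxn
  have hcut : 3 / 4 ≤ cutoff n x := by
    have h1 : euclNorm x ^ 2 ≤ (n / 2) ^ 2 := pow_le_pow_left₀ (euclNorm_nonneg x) hx2 2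
    have h2 : euclNorm x ^ 2 / n ^ 2 ≤ 1 / 4 := by
      rw [div_le_iff₀ (by positivity)]; linarith
    rw [cutoff]; linarith
  have hg := gradSq_nonneg f x
  have hle : (f (x + stepVec s) - f x) ^ 2 ≤ gradSq f x :=
    Finset.single_le_sum (f := fun s => (f (x + stepVec s) - f x) ^ 2)
      (fun _ _ => sq_nonneg _) (Finset.mem_univ s)
  have hfx := hf x
  have h3 : (1 / 4) * gradSq f x ≤ cutoff n x ^ 2 * gradSq f x := by gcongr; nlinarith
  have h4 : (f (x + stepVec s) - f x) ^ 2 ≤ (gradConst d / n * f x) ^ 2 := by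
    have : (gradConst d / n * f x) ^ 2 =
        4 * ((585 * Fintype.card (Step d) ^ 4 / n) ^ 2 * f x ^ 2) := by
      unfold gradConst; ring
    rw [this]; linarith
  have h5 := le_of_sq_le_sq h4 (by have := gradConst_nonneg d; positivity)
  linarith

/-- From a nonzero lattice point a step along a nonzero coordinate, towards the origin, decreases
the `ℓ¹` norm by one and does not increase the Euclidean norm. -/
theorem exists_step_toward_zero {d : ℕ} {x : Site d} (hx : x ≠ 0) :
    ∃ s : Step d, euclNorm (x + stepVec s) ≤ euclNorm x ∧
      ∑ i, ((x + stepVec s) i).natAbs + 1 = ∑ i, (x i).natAbs := by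
  obtain ⟨i, hi⟩ := Function.ne_iff.1 hx
  have hi : x i ≠ 0 := hi
  refine ⟨(i, decide (x i < 0)), ?_, ?_⟩
  · refine le_of_sq_le_sq ?_ (euclNorm_nonneg x)
    rw [euclNorm_add_stepVec_sq]
    simp only [stepSign, decide_eq_true_eq]
    split_ifs with h
    · have : (x i : ℝ) ≤ -1 := by exact_mod_cast (show x i ≤ -1 by omega)
      linarith
    · have : (1 : ℝ) ≤ x i := by exact_mod_cast (show 1 ≤ x i by omega)
      linarith
  · rw [← Finset.add_sum_erase _ _ (Finset.mem_univ i),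
      ← Finset.add_sum_erase (a := i) (f := fun i => (x i).natAbs) _ (Finset.mem_univ i)]
    have h1 : ∑ j ∈ Finset.univ.erase i, ((x + stepVec (i, decide (x i < 0))) j).natAbs =
        ∑ j ∈ Finset.univ.erase i, (x j).natAbs := by
      refine Finset.sum_congr rfl fun j hj => ?_
      have : j ≠ i := Finset.ne_of_mem_erase hj
      simp [stepVec, this]
    rw [h1]
    have h2 : ((x + stepVec (i, decide (x i < 0))) i).natAbs + 1 = (x i).natAbs := by
      simp only [Pi.add_apply, stepVec, Pi.single_eq_same, decide_eq_true_eq]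
      split_ifs <;> omega
    omega

/-- Comparison of the value at the origin with the value at `x`, along a lattice path of length
`‖x‖₁` that stays in the ball of half the radius. -/
theorem apply_zero_le_pow_mul {d : ℕ} [NeZero d] {n : ℝ} (hn : 0 < n) {f : Site d → ℝ}
    (hf : ∀ y, 0 < f y)
    (hu : ∀ x ∈ latticeBall d n, LatticeHarmonicAt (fun y => f y ^ 2) x) (L : ℕ) :
    ∀ x ∈ latticeBall d (n / 2), ∑ i, (x i).natAbs = L →
      f 0 ≤ (1 + gradConst d / n) ^ L * f x := by
  induction L with
  | zero =>
    intro x _ hL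
    have : x = 0 := by
      funext i
      simpa using Finset.sum_eq_zero_iff.1 hL i (Finset.mem_univ i)
    simp [this]
  | succ L ih =>
    intro x hx hL
    have hx0 : x ≠ 0 := by rintro rfl; simp at hL
    obtain ⟨s, hs1, hs2⟩ := exists_step_toward_zero hx0
    have hxs : x + stepVec s ∈ latticeBall d (n / 2) :=
      mem_latticeBall.2 (hs1.trans (mem_latticeBall.1 hx))
    have hK := gradConst_nonneg d
    calc f 0 ≤ (1 + gradConst d / n) ^ L * f (x + stepVec s) := ih _ hxs (by omega)
      _ ≤ (1 + gradConst d / n) ^ L * ((1 + gradConst d / n) * f x) := by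
        gcongr
        exact le_one_add_mul_of_mem_half_ball hn hf hu hx s
      _ = _ := by ring

theorem harnack_of_pos {d : ℕ} [NeZero d] {n : ℝ} (hn : 0 < n) {u : Site d → ℝ}
    (hpos : ∀ y, 0 < u y) (hu : ∀ x ∈ latticeBall d n, LatticeHarmonicAt u x)
    {x : Site d} (hx : x ∈ latticeBall d (n / 2)) :
    Real.exp (-(gradConst d * d)) * u 0 ≤ u x := by
  set f : Site d → ℝ := fun y => √(u y) with hf
  have hsq : (fun y => f y ^ 2) = u := funext fun y => Real.sq_sqrt (hpos y).le
  have hK := gradConst_nonneg d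
  have h := apply_zero_le_pow_mul hn (f := f) (fun y => Real.sqrt_pos.2 (hpos y))
    (by rw [hsq]; exact hu) _ x hx rfl
  set L := ∑ i, (x i).natAbs with hL
  have hLn : (L : ℝ) ≤ d * (n / 2) := by
    rw [hL, Nat.cast_sum]
    refine (Finset.sum_le_card_nsmul _ _ (n / 2) fun i _ => ?_).trans (by simp)
    rw [Nat.cast_natAbs, Int.cast_abs]
    exact (abs_apply_le_euclNorm x i).trans (mem_latticeBall.1 hx)
  have hexp : (1 + gradConst d / n) ^ L ≤ Real.exp (gradConst d * d / 2) := by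
    have h1 : 1 + gradConst d / n ≤ Real.exp (gradConst d / n) := by
      rw [add_comm]; exact Real.add_one_le_exp _
    calc (1 + gradConst d / n) ^ L ≤ Real.exp (gradConst d / n) ^ L := by gcongr
      _ = Real.exp (L * (gradConst d / n)) := (Real.exp_nat_mul _ _).symm
      _ ≤ Real.exp (d * (n / 2) * (gradConst d / n)) := by gcongr
      _ = Real.exp (gradConst d * d / 2) := by congr 1; field_simp
  have hfx : 0 ≤ f x := Real.sqrt_nonneg _
  have h2 : f 0 ≤ Real.exp (gradConst d * d / 2) * f x := h.trans (by gcongr)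
  have h3 : u 0 ≤ Real.exp (gradConst d * d) * u x := by
    have := pow_le_pow_left₀ (Real.sqrt_nonneg (u 0)) h2 2
    rw [mul_pow, ← Real.exp_nat_mul, Real.sq_sqrt (hpos 0).le, Real.sq_sqrt (hpos x).le] at this
    have h4 : ((2 : ℕ) : ℝ) * (gradConst d * d / 2) = gradConst d * d := by push_cast; ring
    rwa [h4] at this
  rw [Real.exp_neg, inv_mul_le_iff₀ (Real.exp_pos _)]
  exact h3

/-- The elliptic Harnack inequality on lattice balls, with a constant that does not depend on the
radius. -/
theorem harnack {d : ℕ} [NeZero d] {n : ℝ} (hn : 0 < n) {u : Site d → ℝ}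
    (hpos : ∀ y, 0 ≤ u y) (hu : ∀ x ∈ latticeBall d n, LatticeHarmonicAt u x)
    {x : Site d} (hx : x ∈ latticeBall d (n / 2)) :
    Real.exp (-(gradConst d * d)) * u 0 ≤ u x := by
  -- Adding a constant to `u` keeps it harmonic and makes it positive.
  refine le_of_forall_pos_le_add fun ε hε => ?_
  have h := harnack_of_pos hn (u := fun y => u y + ε) (fun y => by have := hpos y; linarith)
    (fun y hy => by
      have : ∑ s : Step d, u (y + stepVec s) = Fintype.card (Step d) * u y := hu y hy
      simp only [LatticeHarmonicAt, Finset.sum_add_distrib, this, Finset.sum_const,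
        Finset.card_univ, nsmul_eq_mul]
      ring) hx
  have := mul_pos (Real.exp_pos (-(gradConst d * d))) hε
  linarith

/-! ### The law of one added particle -/

/-- Splitting off the first term of an i.i.d. sequence. -/
theorem infinitePi_map_head_tail {X : Type*} [MeasurableSpace X] (μ : Measure X)
    [IsProbabilityMeasure μ] :
    (Measure.infinitePi fun _ : ℕ => μ).map (fun ω => (ω 0, fun i => ω (i + 1))) =
      μ.prod (Measure.infinitePi fun _ : ℕ => μ) := by
  set c : X × (ℕ → X) → ℕ → X := fun p i => Nat.casesOn i p.1 p.2 with hc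
  have hcm : Measurable c := by
    refine measurable_pi_iff.2 fun i => ?_
    cases i with
    | zero => exact measurable_fst
    | succ i => exact (measurable_pi_apply i).comp measurable_snd
  have hs : Measurable fun ω : ℕ → X => (ω 0, fun i => ω (i + 1)) :=
    (measurable_pi_apply 0).prodMk (measurable_pi_iff.2 fun i => measurable_pi_apply (i + 1))
  have key : (μ.prod (Measure.infinitePi fun _ : ℕ => μ)).map c =
      Measure.infinitePi fun _ : ℕ => μ := by
    refine Measure.eq_infinitePi _ fun s t ht => ?_
    classical
    -- A box over `s` is a box over an initial segment of `ℕ`, with free sides outside `s`.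
    set t' : ℕ → Set X := fun i => if i ∈ s then t i else Set.univ with ht'
    have ht'm : ∀ i, MeasurableSet (t' i) := fun i => by
      simp only [ht']; split_ifs; exacts [ht i, MeasurableSet.univ]
    obtain ⟨N, hN⟩ : ∃ N, s ⊆ Finset.range (N + 1) :=
      ⟨s.sup id, fun i hi => Finset.mem_range_succ_iff.2 (Finset.le_sup (f := id) hi)⟩
    have h1 : (s : Set ℕ).pi t = (Finset.range (N + 1) : Set ℕ).pi t' := by
      ext ω
      simp only [Set.mem_pi, ht', Finset.mem_coe]
      refine ⟨fun h i _ => ?_, fun h i hi => ?_⟩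
      · split_ifs with his
        exacts [h i his, Set.mem_univ _]
      · simpa [hi] using h i (hN hi)
    have h2 : ∏ i ∈ s, μ (t i) = ∏ i ∈ Finset.range (N + 1), μ (t' i) := by
      rw [← Finset.prod_subset hN fun i _ hi => by simp [ht', hi]]
      exact Finset.prod_congr rfl fun i hi => by simp [ht', hi]
    have h3 : c ⁻¹' ((Finset.range (N + 1) : Set ℕ).pi t') =
        t' 0 ×ˢ (Finset.range N : Set ℕ).pi fun i => t' (i + 1) := by
      ext ⟨a, σ⟩
      simp only [Set.mem_preimage, Set.mem_pi, Finset.mem_coe, Finset.mem_range, Set.mem_prod, hc]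
      refine ⟨fun h => ⟨h 0 (by omega), fun i hi => h (i + 1) (by omega)⟩, fun h i hi => ?_⟩
      cases i with
      | zero => exact h.1
      | succ i => exact h.2 i (by omega)
    rw [h1, h2, Measure.map_apply hcm (MeasurableSet.pi (Finset.countable_toSet _)
      fun i _ => ht'm i), h3, Measure.prod_prod, Measure.infinitePi_pi _ fun i _ => ht'm (i + 1),
      Finset.prod_range_succ', mul_comm]
  conv_lhs => rw [← key, Measure.map_map hs hcm]
  exact Measure.map_id

instance (d : ℕ) [NeZero d] : IsProbabilityMeasure (stepLaw d) := by
  unfold stepLaw; infer_instance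

instance (d : ℕ) [NeZero d] : IsProbabilityMeasure (walksLaw d) := by
  unfold walksLaw; infer_instance

theorem stepLaw_singleton (d : ℕ) [NeZero d] (s : Step d) :
    stepLaw d {s} = (Fintype.card (Step d) : ENNReal)⁻¹ := by
  rw [stepLaw, PMF.toMeasure_apply_singleton _ _ (measurableSet_singleton s),
    PMF.uniformOfFintype_apply]

theorem walk_succ {d : ℕ} (x : Site d) (σ : ℕ → Step d) (t : ℕ) :
    walk x σ (t + 1) = walk (x + stepVec (σ 0)) (fun i => σ (i + 1)) t := by
  rw [walk, walk, Finset.sum_range_succ']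
  abel

theorem measurable_walk {d : ℕ} (x : Site d) : Measurable (walk x : (ℕ → Step d) → ℕ → Site d) := by
  refine measurable_pi_iff.2 fun t => ?_
  exact measurable_const.add (Finset.measurable_sum _ fun j _ =>
    (measurable_of_countable stepVec).comp (measurable_pi_apply j))

theorem measurable_exitTime {d : ℕ} (S : Finset (Site d)) :
    Measurable (exitTime S : (ℕ → Site d) → ℕ) := by
  refine measurable_of_Iic fun t => ?_
  have : exitTime S ⁻¹' Set.Iic t =
      (⋃ j ∈ Set.Iic t, {ξ : ℕ → Site d | ξ j ∉ S}) ∪ ⋂ j, {ξ : ℕ → Site d | ξ j ∈ S} := by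
    ext ξ
    simp only [Set.mem_preimage, Set.mem_Iic, Set.mem_union, Set.mem_iUnion, Set.mem_iInter,
      Set.mem_ofPred_eq, exitTime]
    constructor
    · intro h
      by_cases hne : {t | ξ t ∉ S}.Nonempty
      · exact Or.inl ⟨_, h, Nat.sInf_mem hne⟩
      · refine Or.inr fun j => ?_
        by_contra hj
        exact hne ⟨j, hj⟩
    · rintro (⟨j, hj, hjS⟩ | h)
      · exact (Nat.sInf_le (m := j) hjS).trans hj
      · have : {t | ξ t ∉ S} = ∅ := by ext j; simp [h j]
        simp [this]
  rw [this]
  refine (MeasurableSet.biUnion (Set.to_countable _) fun j _ => ?_).union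
    (MeasurableSet.iInter fun j => ?_)
  · exact (measurable_of_countable fun y : Site d => y ∉ S).comp (measurable_pi_apply j) |>.setOf
  · exact (measurable_of_countable fun y : Site d => y ∈ S).comp (measurable_pi_apply j) |>.setOf

theorem measurable_addParticle {d : ℕ} (S : Finset (Site d)) :
    Measurable fun ξ : ℕ → Site d => addParticle ξ S := by
  have h1 : Measurable fun p : ℕ × (ℕ → Site d) => p.2 p.1 :=
    measurable_from_prod_countable_right fun t => measurable_pi_apply t
  have h2 : Measurable fun ξ : ℕ → Site d => ξ (exitTime S ξ) :=
    h1.comp ((measurable_exitTime S).prodMk measurable_id)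
  exact (measurable_of_countable fun y : Site d => insert y S).comp h2

theorem measurable_aggregate {d : ℕ} (l : List (Site d)) :
    Measurable fun p : Finset (Site d) × (ℕ → ℕ → Step d) => aggregate l p.1 p.2 := by
  induction l with
  | nil => exact measurable_fst
  | cons x l ih =>
    refine measurable_from_prod_countable_right fun S => ?_
    refine ih.comp (Measurable.prodMk ?_ ?_)
    · exact (measurable_addParticle S).comp ((measurable_walk x).comp (measurable_pi_apply 0))
    · exact measurable_pi_iff.2 fun i => measurable_pi_apply (i + 1)

theorem measurable_aggregate_right {d : ℕ} (l : List (Site d)) (S : Finset (Site d)) :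
    Measurable (aggregate l S) :=
  (measurable_aggregate l).comp measurable_prodMk_left

/-- The law of the aggregate after one particle, launched from `x`, is added to `S`. -/
def addLaw {d : ℕ} [NeZero d] (x : Site d) (S : Finset (Site d)) : Measure (Finset (Site d)) :=
  (Measure.infinitePi fun _ : ℕ => stepLaw d).map fun σ => addParticle (walk x σ) S

theorem measurable_addParticle_walk {d : ℕ} (x : Site d) (S : Finset (Site d)) :
    Measurable fun σ : ℕ → Step d => addParticle (walk x σ) S :=
  (measurable_addParticle S).comp (measurable_walk x)

instance {d : ℕ} [NeZero d] (x : Site d) (S : Finset (Site d)) :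
    IsProbabilityMeasure (addLaw x S) :=
  Measure.isProbabilityMeasure_map (measurable_addParticle_walk x S).aemeasurable

instance {d : ℕ} [NeZero d] (l : List (Site d)) (S : Finset (Site d)) :
    IsProbabilityMeasure (idlaLaw l S) :=
  Measure.isProbabilityMeasure_map (measurable_aggregate_right l S).aemeasurable

/-- The Markov property at the first step. It holds for every trajectory, also for those that never
leave `S`, as then neither side adds a site. -/
theorem addParticle_walk_of_mem {d : ℕ} {x : Site d} {S : Finset (Site d)} (hx : x ∈ S)
    (σ : ℕ → Step d) :
    addParticle (walk x σ) S =
      addParticle (walk (x + stepVec (σ 0)) fun i => σ (i + 1)) S := by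
  have hw0 : walk x σ 0 = x := by simp [walk]
  have hset : ∀ t, t + 1 ∈ {t | walk x σ t ∉ S} ↔
      t ∈ {t | walk (x + stepVec (σ 0)) (fun i => σ (i + 1)) t ∉ S} := fun t => by
    simp [walk_succ]
  by_cases hne : {t | walk (x + stepVec (σ 0)) (fun i => σ (i + 1)) t ∉ S}.Nonempty
  · have h0 : 0 ∉ {t | walk x σ t ∉ S} := by simp [hw0, hx]
    have hE : exitTime S (walk x σ) =
        exitTime S (walk (x + stepVec (σ 0)) fun i => σ (i + 1)) + 1 := by
      have hne' : {t | walk x σ t ∉ S}.Nonempty := hne.imp' Nat.succ fun t ht => (hset t).2 ht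
      have hpos : exitTime S (walk x σ) ≠ 0 := fun h => h0 (by
        have := Nat.sInf_mem hne'
        rw [exitTime] at h
        rwa [h] at this)
      obtain ⟨m, hm⟩ := Nat.exists_eq_succ_of_ne_zero hpos
      have h1 : exitTime S (walk (x + stepVec (σ 0)) fun i => σ (i + 1)) ≤ m :=
        Nat.sInf_le ((hset m).1 (by
          have := Nat.sInf_mem hne'
          rw [exitTime] at hm
          rwa [hm] at this))
      have h2 : exitTime S (walk x σ) ≤
          exitTime S (walk (x + stepVec (σ 0)) fun i => σ (i + 1)) + 1 :=
        Nat.sInf_le ((hset _).2 (Nat.sInf_mem hne))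
      omega
    rw [addParticle, addParticle, hE, walk_succ]
  · have hin : ∀ t, walk (x + stepVec (σ 0)) (fun i => σ (i + 1)) t ∈ S := fun t => by
      by_contra h
      exact hne ⟨t, h⟩
    have hin' : ∀ t, walk x σ t ∈ S := fun t => by
      cases t with
      | zero => rwa [hw0]
      | succ t => rw [walk_succ]; exact hin t
    rw [addParticle, addParticle, Finset.insert_eq_of_mem (hin' _),
      Finset.insert_eq_of_mem (hin _)]

/-- The probability that a particle launched from `y` turns `S` into `T` is harmonic in `y` on `S`.
This includes `T = S`, the event that the particle never leaves, so recurrence properties of the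
walk play no role. -/
theorem latticeHarmonicAt_addLaw {d : ℕ} [NeZero d] {S : Finset (Site d)}
    (T : Finset (Site d)) {x : Site d} (hx : x ∈ S) :
    LatticeHarmonicAt (fun y => (addLaw y S).real {T}) x := by
  have hm : Measurable fun p : Step d × (ℕ → Step d) =>
      addParticle (walk (x + stepVec p.1) p.2) S :=
    measurable_from_prod_countable_right fun s => measurable_addParticle_walk (x + stepVec s) S
  have hs : Measurable fun ω : ℕ → Step d => (ω 0, fun i => ω (i + 1)) :=
    (measurable_pi_apply 0).prodMk (measurable_pi_iff.2 fun i => measurable_pi_apply (i + 1))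
  have h1 : addLaw x S = ((stepLaw d).prod (Measure.infinitePi fun _ : ℕ => stepLaw d)).map
      fun p => addParticle (walk (x + stepVec p.1) p.2) S := by
    rw [← infinitePi_map_head_tail, Measure.map_map hm hs, addLaw]
    congr 1
    funext σ
    exact addParticle_walk_of_mem hx σ
  have h2 : addLaw x S {T} =
      ∑ s : Step d, addLaw (x + stepVec s) S {T} * (Fintype.card (Step d) : ENNReal)⁻¹ := by
    rw [h1, Measure.map_apply hm (measurableSet_singleton T),
      Measure.prod_apply (hm (measurableSet_singleton T)), lintegral_fintype]
    refine Finset.sum_congr rfl fun s _ => ?_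
    rw [stepLaw_singleton, addLaw, Measure.map_apply (measurable_addParticle_walk _ S)
      (measurableSet_singleton T)]
    rfl
  have hD : (Fintype.card (Step d) : ℝ) ≠ 0 := by
    have := one_le_card_step d; positivity
  have h3 : (addLaw x S).real {T} =
      (∑ s : Step d, (addLaw (x + stepVec s) S).real {T}) * (Fintype.card (Step d) : ℝ)⁻¹ := by
    rw [measureReal_def, h2, ENNReal.toReal_sum fun s _ => ENNReal.mul_ne_top
      (measure_ne_top _ _) (by simp [NeZero.ne d]), Finset.sum_mul]
    simp [measureReal_def]
  simp only [LatticeHarmonicAt]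
  rw [h3]
  field_simp

theorem measure_le_of_singleton_le {α : Type*} [MeasurableSpace α] [Countable α]
    [MeasurableSingletonClass α] {μ ν : Measure α} (h : ∀ a, μ {a} ≤ ν {a}) : μ ≤ ν := by
  refine Measure.le_iff.2 fun s hs => ?_
  rw [← Measure.tsum_indicator_apply_singleton μ s hs,
    ← Measure.tsum_indicator_apply_singleton ν s hs]
  exact ENNReal.tsum_le_tsum fun a => Set.indicator_le_indicator (h a)

/-- The probability with which a particle launched from the half ball can be replaced by one
launched from the origin. -/
def harnackConst (d : ℕ) : ℝ := Real.exp (-(gradConst d * d))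

theorem harnackConst_pos (d : ℕ) : 0 < harnackConst d := Real.exp_pos _

theorem harnackConst_le_one (d : ℕ) : harnackConst d ≤ 1 := by
  have := gradConst_nonneg d
  exact Real.exp_le_one_iff.2 (by simp; positivity)

/-- Harnack's inequality for the law of the added site, uniformly over all aggregates that contain
the ball. -/
theorem smul_addLaw_zero_le {d : ℕ} [NeZero d] {n : ℝ} (hn : 0 < n) {S : Finset (Site d)}
    (hS : latticeBall d n ⊆ S) {x : Site d} (hx : x ∈ latticeBall d (n / 2)) :
    ENNReal.ofReal (harnackConst d) • addLaw 0 S ≤ addLaw x S := by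
  refine measure_le_of_singleton_le fun T => ?_
  have h := harnack hn (u := fun y => (addLaw y S).real {T}) (fun _ => measureReal_nonneg)
    (fun y hy => latticeHarmonicAt_addLaw T (hS hy)) hx
  rw [Measure.smul_apply, smul_eq_mul, ← ofReal_measureReal, ← ofReal_measureReal,
    ← ENNReal.ofReal_mul (harnackConst_pos d).le]
  exact ENNReal.ofReal_le_ofReal h

/-! ### Coupling of the aggregates -/

/-- The aggregate is a Markov chain: one particle is added, then independently the others. -/
theorem idlaLaw_cons {d : ℕ} [NeZero d] (x : Site d) (l : List (Site d)) (S : Finset (Site d)) :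
    idlaLaw (x :: l) S = (addLaw x S).bind (idlaLaw l) := by
  have hG : Measurable fun p : (ℕ → Step d) × (ℕ → ℕ → Step d) =>
      aggregate l (addParticle (walk x p.1) S) p.2 :=
    (measurable_aggregate l).comp
      (((measurable_addParticle_walk x S).comp measurable_fst).prodMk measurable_snd)
  have hs : Measurable fun ω : ℕ → ℕ → Step d => (ω 0, fun i => ω (i + 1)) :=
    (measurable_pi_apply 0).prodMk (measurable_pi_iff.2 fun i => measurable_pi_apply (i + 1))
  have h1 : idlaLaw (x :: l) S =
      ((Measure.infinitePi fun _ : ℕ => stepLaw d).prod (walksLaw d)).map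
        fun p => aggregate l (addParticle (walk x p.1) S) p.2 := by
    rw [walksLaw, ← infinitePi_map_head_tail, Measure.map_map hG hs]
    rfl
  ext A hA
  rw [h1, Measure.map_apply hG hA, Measure.prod_apply (hG hA),
    Measure.bind_apply hA (measurable_of_countable _).aemeasurable, addLaw,
    lintegral_map (measurable_of_countable _) (measurable_addParticle_walk x S)]
  refine lintegral_congr fun σ => ?_
  exact (Measure.map_apply (μ := walksLaw d)
    (measurable_aggregate_right l (addParticle (walk x σ) S)) hA).symm

theorem idlaOriginLaw_eq_bind {d : ℕ} [NeZero d] (ν : Measure ℕ) [SFinite ν]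
    (S : Finset (Site d)) :
    idlaOriginLaw ν S = ν.bind fun j => idlaLaw (List.replicate j 0) S := by
  have hG : ∀ j : ℕ, Measurable fun ω : ℕ → ℕ → Step d =>
      aggregate (List.replicate j 0) S ω := fun j =>
    measurable_aggregate_right _ S
  have hG' : Measurable fun p : ℕ × (ℕ → ℕ → Step d) =>
      aggregate (List.replicate p.1 0) S p.2 := measurable_from_prod_countable_right hG
  ext A hA
  rw [idlaOriginLaw, Measure.map_apply hG' hA, Measure.prod_apply (hG' hA),
    Measure.bind_apply hA (measurable_of_countable _).aemeasurable]
  refine lintegral_congr fun j => ?_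
  rw [idlaLaw, Measure.map_apply (hG j) hA]
  rfl

theorem bind_add_left {α β : Type*} [MeasurableSpace α] [MeasurableSpace β] (μ ν : Measure α)
    {f : α → Measure β} (hf : Measurable f) : (μ + ν).bind f = μ.bind f + ν.bind f := by
  ext A hA
  rw [Measure.add_apply, Measure.bind_apply hA hf.aemeasurable,
    Measure.bind_apply hA hf.aemeasurable, Measure.bind_apply hA hf.aemeasurable,
    lintegral_add_measure]

/-- Pascal's rule as an identity between binomial laws: a further trial either succeeds or fails. -/
theorem binomial_succ (k : ℕ) (p : unitInterval) :
    binomial (k + 1) p = ENNReal.ofReal p • (binomial k p).map (· + 1) +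
      ENNReal.ofReal (1 - p) • binomial k p := by
  have hp := p.2.1
  have hp' : (0 : ℝ) ≤ 1 - p := sub_nonneg.2 p.2.2
  refine Measure.ext_of_singleton fun j => ?_
  rw [Measure.add_apply, Measure.smul_apply, Measure.smul_apply, smul_eq_mul, smul_eq_mul,
    Measure.map_apply (measurable_of_countable _) (measurableSet_singleton j),
    binomial_singleton, binomial_singleton]
  cases j with
  | zero =>
    have : (fun x : ℕ => x + 1) ⁻¹' {0} = ∅ := by ext; simp
    rw [this, measure_empty, mul_zero, zero_add, ← ENNReal.ofReal_mul hp']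
    congr 1
    simp [pow_succ]; ring
  | succ j =>
    have : (fun x : ℕ => x + 1) ⁻¹' {j + 1} = {j} := by ext; simp
    rw [this, binomial_singleton, ← ENNReal.ofReal_mul hp, ← ENNReal.ofReal_mul hp',
      ← ENNReal.ofReal_add (mul_nonneg hp binomial_nonneg) (mul_nonneg hp' binomial_nonneg)]
    congr 1
    rw [Nat.choose_succ_succ, Nat.add_sub_add_right]
    push_cast
    rcases Nat.lt_or_ge j k with h | h
    · obtain ⟨m, rfl⟩ := Nat.exists_eq_add_of_lt h
      have e1 : j + m + 1 - j = m + 1 := by omega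
      have e2 : j + m + 1 - (j + 1) = m := by omega
      rw [e1, e2]; ring
    · rw [Nat.choose_eq_zero_of_lt (show k < j + 1 by omega)]
      push_cast; ring

/-- With a further trial, either a further particle is launched from the origin, or none. -/
theorem idlaOriginLaw_binomial_succ {d : ℕ} [NeZero d] (k : ℕ) (p : unitInterval)
    (S : Finset (Site d)) :
    idlaOriginLaw (binomial (k + 1) p) S =
      (ENNReal.ofReal p • addLaw 0 S + ENNReal.ofReal (1 - p) • Measure.dirac S).bind
        (idlaOriginLaw (binomial k p)) := by
  have hm : ∀ f : ℕ → Measure (Finset (Site d)), Measurable f := fun f => measurable_of_countable f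
  have hm' : ∀ f : Finset (Site d) → Measure (Finset (Site d)), Measurable f :=
    fun f => measurable_of_countable f
  rw [bind_add_left _ _ (hm' _), Measure.bind_smul, Measure.bind_smul, Measure.dirac_bind (hm' _),
    idlaOriginLaw_eq_bind, binomial_succ, bind_add_left _ _ (hm _), Measure.bind_smul,
    Measure.bind_smul, ← idlaOriginLaw_eq_bind (binomial k p)]
  congr 2
  ext A hA
  rw [Measure.bind_apply hA (hm _).aemeasurable, lintegral_map (measurable_of_countable _)
    (measurable_of_countable _), Measure.bind_apply hA (hm' _).aemeasurable]
  simp only [List.replicate_succ, idlaLaw_cons, idlaOriginLaw_eq_bind,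
    Measure.bind_apply hA (hm _).aemeasurable, Measure.bind_apply hA (hm' _).aemeasurable]
  exact lintegral_lintegral_swap (measurable_of_countable _).aemeasurable

/-- A coupling of two measures, of equal but arbitrary mass, that is concentrated on the pairs in
which the first set contains the second. -/
def SubsetCoupled {α : Type*} [MeasurableSpace (Finset α)] (μ ν : Measure (Finset α)) : Prop :=
  ∃ ρ : Measure (Finset α × Finset α),
    ρ.map Prod.fst = μ ∧ ρ.map Prod.snd = ν ∧ ∀ᵐ p ∂ρ, p.2 ⊆ p.1

/-- Couplings can be composed along the first step of two Markov chains: `π` couples the states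
after the first step. -/
theorem SubsetCoupled.bind {α : Type*} [Countable α] {μ ν : Measure (Finset α)}
    {A B : Finset α → Measure (Finset α)} (π : Measure (Finset α × Finset α))
    (hfst : π.map Prod.fst = μ) (hsnd : π.map Prod.snd = ν)
    (h : ∀ᵐ p ∂π, SubsetCoupled (A p.1) (B p.2)) :
    SubsetCoupled (μ.bind A) (ν.bind B) := by
  classical
  -- A choice of couplings after the first step; it is measurable because the space is countable.
  set R : Finset α × Finset α → Measure (Finset α × Finset α) := fun p =>
    if hp : SubsetCoupled (A p.1) (B p.2) then hp.choose else 0 with hR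
  have hRm : Measurable R := measurable_of_countable _
  have hAm : Measurable A := measurable_of_countable _
  have hBm : Measurable B := measurable_of_countable _
  have hspec : ∀ p : Finset α × Finset α, SubsetCoupled (A p.1) (B p.2) →
      (R p).map Prod.fst = A p.1 ∧ (R p).map Prod.snd = B p.2 ∧ ∀ᵐ q ∂(R p), q.2 ⊆ q.1 :=
    fun p hp => by
      simp only [hR, hp, dif_pos]
      exact hp.choose_spec
  refine ⟨π.bind R, ?_, ?_, ?_⟩
  · ext T hT
    rw [Measure.map_apply measurable_fst hT,
      Measure.bind_apply (measurable_fst hT) hRm.aemeasurable, ← hfst,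
      Measure.bind_apply hT hAm.aemeasurable,
      lintegral_map (measurable_of_countable _) measurable_fst]
    refine lintegral_congr_ae (h.mono fun p hp => ?_)
    simp only [← (hspec p hp).1, Measure.map_apply measurable_fst hT]
  · ext T hT
    rw [Measure.map_apply measurable_snd hT,
      Measure.bind_apply (measurable_snd hT) hRm.aemeasurable, ← hsnd,
      Measure.bind_apply hT hBm.aemeasurable,
      lintegral_map (measurable_of_countable _) measurable_snd]
    refine lintegral_congr_ae (h.mono fun p hp => ?_)
    simp only [← (hspec p hp).2.1, Measure.map_apply measurable_snd hT]
  · rw [ae_iff, Measure.bind_apply (MeasurableSet.of_discrete) hRm.aemeasurable,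
      lintegral_eq_zero_iff (measurable_of_countable _)]
    exact h.mono fun p hp => ae_iff.1 (hspec p hp).2.2

theorem subset_addParticle {d : ℕ} (ξ : ℕ → Site d) (S : Finset (Site d)) :
    S ⊆ addParticle ξ S := Finset.subset_insert _ _

/-- For a fixed trajectory, adding a particle is monotone in the aggregate: if the site added to `F`
is outside `E`, then the trajectory leaves both sets at the same time. -/
theorem addParticle_mono {d : ℕ} (ξ : ℕ → Site d) {F E : Finset (Site d)} (hFE : F ⊆ E) :
    addParticle ξ F ⊆ addParticle ξ E := by
  refine Finset.insert_subset ?_ (hFE.trans (Finset.subset_insert _ _))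
  by_cases hE : ξ (exitTime F ξ) ∈ E
  · exact Finset.mem_insert_of_mem hE
  · have hle : exitTime F ξ ≤ exitTime E ξ := by
      have hne : {t | ξ t ∉ E}.Nonempty := ⟨_, hE⟩
      exact Nat.sInf_le fun h => Nat.sInf_mem hne (hFE h)
    have hge : exitTime E ξ ≤ exitTime F ξ := Nat.sInf_le hE
    rw [le_antisymm hle hge]
    exact Finset.mem_insert_self _ _

theorem ae_subset_addLaw {d : ℕ} [NeZero d] (x : Site d) (S : Finset (Site d)) :
    ∀ᵐ T ∂(addLaw x S), S ⊆ T := by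
  rw [addLaw, ae_map_iff (measurable_addParticle_walk x S).aemeasurable MeasurableSet.of_discrete]
  exact Filter.Eventually.of_forall fun σ => subset_addParticle _ _

/-- The coupling, particle by particle. With probability `η` the particle launched from `x` is
replaced by one launched from the origin, which both aggregates then receive along the same
trajectory; otherwise only the larger aggregate grows. -/
theorem subsetCoupled_idlaLaw {d : ℕ} [NeZero d] {n : ℝ} (hn : 0 < n) {η : unitInterval}
    (hη : (η : ℝ) = harnackConst d) (l : List (Site d)) (hl : ∀ x ∈ l, x ∈ latticeBall d (n / 2)) :
    ∀ E F : Finset (Site d), latticeBall d n ⊆ F → F ⊆ E →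
      SubsetCoupled (idlaLaw l E) (idlaOriginLaw (binomial l.length η) F) := by
  induction l with
  | nil =>
    intro E F _ hFE
    have h1 : idlaLaw [] E = Measure.dirac E := by
      change (walksLaw d).map (fun _ => E) = _
      simp [Measure.map_const]
    have h2 : idlaOriginLaw (binomial ([] : List (Site d)).length η) F = Measure.dirac F := by
      rw [idlaOriginLaw_eq_bind, List.length_nil, binomial_zero,
        Measure.dirac_bind (measurable_of_countable _)]
      change (walksLaw d).map (fun _ => F) = _
      simp [Measure.map_const]
    refine ⟨Measure.dirac (E, F), ?_, ?_, ?_⟩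
    · rw [h1, Measure.map_dirac' measurable_fst]
    · rw [h2, Measure.map_dirac' measurable_snd]
    · rw [ae_dirac_iff MeasurableSet.of_discrete]
      exact hFE
  | cons x l ih =>
    intro E F hBF hFE
    have hx : x ∈ latticeBall d (n / 2) := hl x (by simp)
    have ih' := ih fun y hy => hl y (List.mem_cons_of_mem _ hy)
    set c : ENNReal := ENNReal.ofReal η with hc
    have hle : c • addLaw 0 E ≤ addLaw x E := by
      rw [hc, hη]; exact smul_addLaw_zero_le hn (hBF.trans hFE) hx
    have : IsFiniteMeasure (c • addLaw 0 E) := isFiniteMeasure_of_le _ hle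
    -- The part of the law of the particle from `x` that is not matched with one from the origin.
    set r : Measure (Finset (Site d)) := addLaw x E - c • addLaw 0 E with hr
    have hadd : c • addLaw 0 E + r = addLaw x E := by
      rw [add_comm]; exact Measure.sub_add_cancel_of_le hle
    have hrmass : r Set.univ = ENNReal.ofReal (1 - η) := by
      rw [hr, Measure.sub_apply MeasurableSet.univ hle, Measure.smul_apply, measure_univ,
        measure_univ, smul_eq_mul, mul_one, hc, ENNReal.ofReal_sub _ η.2.1, ENNReal.ofReal_one]
    have hboth : Measurable fun σ : ℕ → Step d =>
        (addParticle (walk 0 σ) E, addParticle (walk 0 σ) F) :=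
      (measurable_addParticle_walk 0 E).prodMk (measurable_addParticle_walk 0 F)
    have hone : Measurable fun T : Finset (Site d) => (T, F) := measurable_of_countable _
    rw [idlaLaw_cons, List.length_cons, idlaOriginLaw_binomial_succ]
    refine SubsetCoupled.bind (c • (Measure.infinitePi fun _ : ℕ => stepLaw d).map
      (fun σ => (addParticle (walk 0 σ) E, addParticle (walk 0 σ) F)) + r.map fun T => (T, F))
      ?_ ?_ ?_
    · rw [Measure.map_add _ _ measurable_fst, Measure.map_smul,
        Measure.map_map measurable_fst hboth, Measure.map_map measurable_fst hone, ← hadd]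
      congr 1
      exact Measure.map_id
    · rw [Measure.map_add _ _ measurable_snd, Measure.map_smul,
        Measure.map_map measurable_snd hboth, Measure.map_map measurable_snd hone, ← hrmass,
        ← Measure.map_const]
      rfl
    · rw [ae_add_measure_iff]
      constructor
      · refine Measure.ae_smul_measure ?_ c
        rw [ae_map_iff hboth.aemeasurable MeasurableSet.of_discrete]
        exact Filter.Eventually.of_forall fun σ =>
          ih' _ _ (hBF.trans (subset_addParticle _ _)) (addParticle_mono _ hFE)
      · rw [ae_map_iff hone.aemeasurable MeasurableSet.of_discrete]
        have hr_le : r ≤ addLaw x E := Measure.sub_le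
        have hE : ∀ᵐ T ∂r, E ⊆ T := ae_mono hr_le (ae_subset_addLaw x E)
        exact hE.mono fun T hT => ih' T F hBF (hFE.trans hT)

end

theorem mainTheorem9 (d : ℕ) [NeZero d] :
    ∃ η : unitInterval, 0 < η ∧
      ∀ (n : ℝ), 0 < n →
        ∀ (k : ℕ) (X : Multiset (Site d)), Multiset.card X = k →
          (∀ x ∈ X, x ∈ latticeBall d (n / 2)) →
            ∀ l : List (Site d), (l : Multiset (Site d)) = X →
              StochDominates (idlaLaw l (latticeBall d n))
                (idlaOriginLaw (binomial k η) (latticeBall d n)) := by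
  refine ⟨⟨harnackConst d, (harnackConst_pos d).le, harnackConst_le_one d⟩,
    harnackConst_pos d, fun n hn k X hk hX l hl => ?_⟩
  subst hl
  rw [Multiset.coe_card] at hk
  subst hk
  obtain ⟨ρ, h1, h2, h3⟩ := subsetCoupled_idlaLaw hn
    (η := ⟨harnackConst d, (harnackConst_pos d).le, harnackConst_le_one d⟩) rfl l
    (fun x hx => hX x (Multiset.mem_coe.2 hx)) (latticeBall d n) (latticeBall d n)
    subset_rfl subset_rfl
  refine ⟨ρ, ⟨?_⟩, h1, h2, h3⟩
  have : (ρ.map Prod.fst) Set.univ = 1 := by rw [h1]; exact measure_univ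
  rwa [Measure.map_apply measurable_fst MeasurableSet.univ] at this
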